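/- Let $E\subset\mathbb Z^k$ and let $\mathcal Z(t)=(A(t),M(t))$, $t\in\mathbb N$, be a Markov-additive process on $\mathbb Z^d\times E\subset\mathbb Z^{d+k}$: a (possibly strictly substochastic) Markov chain with transition probabilities $p(z,z')$, $\sum_{z'}p(z,z')\le 1$, such that $p((x,y),(x',y'))=p((0,y),(x'-x,y'))$ for all $x,x'\in\mathbb Z^d$, $y,y'\in E$. Let $p^{(n)}$ be the $n$-step transition probabilities, $\mathcal G(z,z')=\sum_{n\ge 0}p^{(n)}(z,z')$ the Green function, $|\cdot|$ the Euclidean norm, and, for $a\in\mathbb R^{d+k}$, $$\varphi_z(a)=\mathbb E_z\bigl(e^{a\cdot(\mathcal Z(1)-z)}\bigr)=\sum_{z'}p(z,z')e^{a\cdot(z'-z)},\qquad \hat\varphi(a)=\sup_{z\in\mathbb Z^d\times E}\varphi_z(a).$$ Suppose that $\mathcal Z$ is transient (i.e. $\mathcal G(z,z)<\infty$ for every $z$) and that the following conditions hold. (A1') There are $\theta>0$ and $C>0$ such that for any $z\ne z'$ in $\mathbb Z^d\times E$ there are $n\le C|z'-z|$ and points $z_0=z,z_1,\dots,z_n=z'$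 of $\mathbb Z^d\times E$ with $|z_i-z_{i-1}|\le C$ and $p(z_{i-1},z_i)\ge\theta$ for $i=1,\dots,n$. (A2) $\hat\varphi$ is finite in a neighbourhood of zero. Let $z_n\in\mathbb Z^d\times E$ be a sequence with $|z_n|\to\infty$ such that, for some $z_0\in\mathbb Z^d\times E$, $$\liminf_{n\to\infty}\frac1{|z_n|}\log\mathcal G(z_0,z_n)\ge 0.$$ Let $\hat k$ be the greatest common divisor of the set of all integers $m>0$ with $\inf_{z}p^{(m)}(z,z)>0$. Then $$\lim_{n\to\infty}\frac{\mathcal G(z+\hat k w,z_n)}{\mathcal G(z,z_n)}=1\qquad\text{for all } z\in\mathbb Z^d\times E,\ w\in\mathbb Z^d\times\{0\}.$$ If, moreover, the conditions (A2') $\varphi_z$ is finite everywhere on $\mathbb R^{d+k}$ for every $z\in\mathbb Z^d\times E$, and $\hat\varphi$ is finite in a neighbourhood of zero, (A3) up to multiplication by constants, $h$ is the unique positive harmonic function on $\mathbb Z^d\times E$ (i.e. $h>0$ and $\sum_{z'}p(z,z')h(z')=h(z)$ for all $z$) with $h(z+\hat kw)=h(z)$ for all $z\in\mathbb Z^d\times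 E$, $w\in\mathbb Z^d\times\{0\}$, are also satisfied, then $$\lim_{n\to\infty}\frac{\mathcal G(z,z_n)}{\mathcal G(z',z_n)}=\frac{h(z)}{h(z')}\qquad\text{for all } z,z'\in\mathbb Z^d\times E.$$ -/

import Mathlib

open Filter Topology
open scoped ENNReal NNReal

namespace MarkovAdditive

/-- The state space `ℤ^d × E`, where `E ⊆ ℤ^k`. -/
abbrev State (d : ℕ) {k : ℕ} (E : Set (Fin k → ℤ)) : Type := (Fin d → ℤ) × E

/-- The point of `ℝ^(d+k)` (with its Euclidean norm and inner product) given by a state. -/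
noncomputable def pos {d k : ℕ} {E : Set (Fin k → ℤ)} (z : State d E) :
    EuclideanSpace ℝ (Fin d ⊕ Fin k) :=
  WithLp.toLp 2 (Sum.elim (fun i => (z.1 i : ℝ)) (fun j => (z.2.1 j : ℝ)))

/-- The translate `z + w` of a state `z = (x, y)` by `w ∈ ℤ^d × {0}`. -/
def shift {d k : ℕ} {E : Set (Fin k → ℤ)} (z : State d E) (w : Fin d → ℤ) : State d E :=
  (z.1 + w, z.2)

/-- A (possibly strictly substochastic) Markov-additive transition matrix on `ℤ^d × E`. -/
structure Chain (d : ℕ) {k : ℕ} (E : Set (Fin k → ℤ)) where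
  /-- one-step transition probabilities -/
  p : State d E → State d E → ℝ≥0∞
  substochastic : ∀ z, ∑' z', p z z' ≤ 1
  additive : ∀ (x x' : Fin d → ℤ) (y y' : E), p (x, y) (x', y') = p (0, y) (x' - x, y')

namespace Chain

variable {d k : ℕ} {E : Set (Fin k → ℤ)} (P : Chain d E)

/-- The `n`-step transition probability `p^(n)(z, z') = ℙ_z(Z(n) = z')`. -/
noncomputable def step : ℕ → State d E → State d E → ℝ≥0∞
  | 0, z, z' => if z = z' then 1 else 0
  | n + 1, z, z' => ∑' u, P.p z u * step n u z'

/-- Green's function. -/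
noncomputable def green (z z' : State d E) : ℝ≥0∞ := ∑' n, P.step n z z'

/-- Every state is transient: the expected number of visits to a state started there is finite. -/
def Transient : Prop := ∀ z, P.green z z < ∞

/-- The communication condition. -/
def Communication : Prop :=
  ∃ θ C : ℝ, 0 < θ ∧ 0 < C ∧ ∀ z z' : State d E, z ≠ z' →
    ∃ (n : ℕ) (ζ : ℕ → State d E), ζ 0 = z ∧ ζ n = z' ∧ (n : ℝ) ≤ C * ‖pos z' - pos z‖ ∧
      ∀ i < n, ‖pos (ζ (i + 1)) - pos (ζ i)‖ ≤ C ∧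
        ENNReal.ofReal θ ≤ P.p (ζ i) (ζ (i + 1))

/-- The jump generating function `φ_z(a) = 𝔼_z(exp(a · (Z(1) - z)))`. -/
noncomputable def jumpGen (z : State d E) (a : EuclideanSpace ℝ (Fin d ⊕ Fin k)) : ℝ≥0∞ :=
  ∑' z', P.p z z' * ENNReal.ofReal (Real.exp (inner ℝ a (pos z' - pos z)))

/-- `φ̂ = sup_z φ_z` is finite in a neighbourhood of zero. -/
def UniformExpMoments : Prop :=
  ∀ᶠ a : EuclideanSpace ℝ (Fin d ⊕ Fin k) in 𝓝 0, (⨆ z, P.jumpGen z a) < ∞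

/-- Every `φ_z` is finite everywhere, and `φ̂` is finite in a neighbourhood of zero. -/
def AllExpMoments : Prop :=
  (∀ (z : State d E) (a : EuclideanSpace ℝ (Fin d ⊕ Fin k)), P.jumpGen z a < ∞) ∧
    P.UniformExpMoments

/-- The positive times with a return probability bounded away from zero uniformly. -/
def returnTimes : Set ℕ := {n | 0 < n ∧ 0 < ⨅ z, P.step n z z}

/-- The greatest common divisor of the set of uniform return times. -/
noncomputable def kHat : ℕ := Nat.setGcd P.returnTimes

/-- `h` is a (strictly) positive harmonic function which is invariant under all the translations
by `kHat • w`, `w ∈ ℤ^d × {0}`. -/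
structure IsPosPeriodicHarmonic (h : State d E → ℝ≥0) : Prop where
  positive : ∀ z, 0 < h z
  harmonic : ∀ z, ∑' z', P.p z z' * (h z' : ℝ≥0∞) = h z
  periodic : ∀ (z : State d E) (w : Fin d → ℤ), h (shift z (P.kHat • w)) = h z

/-- `h` is, up to multiplication by constants, the unique positive harmonic function with the
above invariance. -/
def IsUniquePosPeriodicHarmonic (h : State d E → ℝ≥0) : Prop :=
  P.IsPosPeriodicHarmonic h ∧
    ∀ h' : State d E → ℝ≥0, P.IsPosPeriodicHarmonic h' → ∃ c : ℝ≥0, ∀ z, h' z = c * h z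

end Chain

end MarkovAdditive

namespace MarkovAdditive

/-! ### Binomial smoothing for commuting positive operators. -/

section Smoothing

variable {S : Type*}

/-! Let `T` be translation by `kHat • w`. At a suitable time `N` the chain stays put or moves by
`kHat • w` with probabilities bounded below (`exists_minorized`), so its `N`-step operator is `ε (1
+ T) + R` with `R ≥ 0`. Since the chain is Markov-additive, `R` commutes with `T`. The powers of
this operator thus contain the binomial weights of `(1 + T) ^ j`, and applying `T` shifts these by
one index. Consecutive binomial coefficients have ratio at least `η < 1` except in a tail of
exponentially small relative mass. Hence `η p⁽ᵐ⁾(z, u) ≤ p⁽ᵐ⁾(z + kHat w, u)` up to an error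
geometric in `m` (`exists_step_smoothing`).

Uniform exponential moments make `p⁽ᵐ⁾(z, u)` exponentially small in `|u - z|` unless `m` is at
least of that order. Summing over `m` therefore gives the same inequality for Green functions with
an error exponentially small in `|u - z|` (`exists_green_smoothing`). Along `zs` the Green function
decays subexponentially, so the error is negligible. Letting `η → 1`, and using `-w` for the reverse
bound, gives the first limit.

For the second limit, normalized Green kernels have limits along every ultrafilter. By dominated
convergence and the first limit these are positive, harmonic and periodic
(`exists_isPosPeriodicHarmonic_limit`), so uniqueness of `h` identifies them all. -/

theorem end_mono (A : Module.End ℝ≥0∞ (S → ℝ≥0∞)) {f g : S → ℝ≥0∞} (h : f ≤ g) :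
    A f ≤ A g := by
  obtain ⟨e, rfl⟩ := exists_add_of_le h
  rw [map_add]
  exact le_self_add

/-- The numerical form of the smoothing estimate: the ratio of consecutive binomial coefficients
is at least `η`, up to an exponentially small total mass. -/
theorem binomial_smoothing {η s t : ℝ} (hs : 0 ≤ s) (ht : 0 ≤ t) {x : ℝ}
    (hη1 : η ≤ 1) (hx : 0 ≤ x) (hsx : s = Real.exp (-x)) (htx : t = Real.exp (η * x)) (j i : ℕ)
    (hij : i + 1 ≤ j) :
    η * (j.choose (i + 1) : ℝ) ≤
      j.choose i + t * (s ^ (i + 1) * t ^ (j - (i + 1)) * j.choose (i + 1)) := by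
  have hrec : (j.choose (i + 1) : ℝ) * (i + 1) = j.choose i * (j - i) := by
    have h := Nat.choose_succ_right_eq j i
    have h2 : ((j.choose (i + 1) * (i + 1) : ℕ) : ℝ) = ((j.choose i * (j - i) : ℕ) : ℝ) := by
      rw [h]
    push_cast [Nat.cast_sub (show i ≤ j by omega)] at h2
    exact h2
  have hij' : (i : ℝ) + 1 ≤ j := by exact_mod_cast hij
  have hc0 : (0 : ℝ) ≤ j.choose (i + 1) := by positivity
  have hd0 : (0 : ℝ) ≤ j.choose i := by positivity
  -- The ratio of the two coefficients is `(i + 1) / (j - i)`. If it is below `η`, the exponential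
  -- tilt is at least `1` and the error term alone suffices.
  rcases le_total (η * (j - i)) (i + 1) with h | h
  · have h1 : η * (j.choose (i + 1) : ℝ) ≤ j.choose i := by
      have hpos : (0 : ℝ) < j - i := by linarith
      refine le_of_mul_le_mul_right ?_ hpos
      rw [← hrec]
      nlinarith
    have h2 : 0 ≤ t * (s ^ (i + 1) * t ^ (j - (i + 1)) * (j.choose (i + 1) : ℝ)) := by positivity
    linarith
  · have h1 : 1 ≤ t * (s ^ (i + 1) * t ^ (j - (i + 1))) := by
      have : t * (s ^ (i + 1) * t ^ (j - (i + 1))) = Real.exp ((η * (j - i) - (i + 1)) * x) := by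
        rw [hsx, htx, ← Real.exp_nat_mul, ← Real.exp_nat_mul, ← Real.exp_add, ← Real.exp_add,
          Nat.cast_sub hij]
        congr 1
        push_cast
        ring
      rw [this]
      exact Real.one_le_exp (mul_nonneg (by linarith) hx)
    nlinarith

/-- A Chernoff tilt: `exp (-x) + exp (η x) = 2 - (1 - η) x + O(x²)`, which is below `2` for small `x
> 0`. -/
theorem exists_smoothing_weights {η : ℝ} (hη : 0 ≤ η) (hη1 : η < 1) :
    ∃ s t : ℝ≥0, s + t < 2 ∧ η ≤ t ∧ 1 ≤ t ∧ ∀ j i : ℕ, i + 1 ≤ j →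
      η * (j.choose (i + 1) : ℝ) ≤
        j.choose i + t * (s ^ (i + 1) * t ^ (j - (i + 1)) * j.choose (i + 1)) := by
  -- With this choice the linear gain is `4 x²`, while the two quadratic remainders cost at most `2
  -- x²`.
  set x : ℝ := (1 - η) / 4 with hx
  have hx0 : 0 < x := by rw [hx]; linarith
  have hx1 : x ≤ 1 / 4 := by rw [hx]; linarith
  have h1 := Real.abs_exp_sub_one_sub_id_le (x := -x) (by rw [abs_le]; constructor <;> linarith)
  have h2 := Real.abs_exp_sub_one_sub_id_le (x := η * x) (by
    rw [abs_le]; constructor <;> nlinarith)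
  have ht1 : 1 ≤ Real.exp (η * x) := Real.one_le_exp (by positivity)
  refine ⟨⟨Real.exp (-x), (Real.exp_pos _).le⟩, ⟨Real.exp (η * x), (Real.exp_pos _).le⟩,
    ?_, ?_, ?_, ?_⟩
  · rw [← NNReal.coe_lt_coe]
    push_cast
    change Real.exp (-x) + Real.exp (η * x) < 2
    have h3 := (abs_le.1 h1).2
    have h4 := (abs_le.1 h2).2
    have h5 : (η * x) ^ 2 ≤ x ^ 2 := by
      apply pow_le_pow_left₀ (by positivity)
      nlinarith
    have h6 : η = 1 - 4 * x := by rw [hx]; ring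
    have h7 : η * x = x - 4 * x ^ 2 := by rw [h6]; ring
    nlinarith [sq_nonneg x, sq_pos_of_pos hx0]
  · change η ≤ Real.exp (η * x)
    linarith
  · exact NNReal.coe_le_coe.1 ht1
  · intro j i hij
    exact binomial_smoothing (Real.exp_pos _).le (Real.exp_pos _).le hη1.le hx0.le rfl rfl j i hij

theorem sum_binomial_smoothing {η s t : ℝ≥0} (hηt : η ≤ t) (ht1 : 1 ≤ t)
    (h : ∀ j i : ℕ, i + 1 ≤ j → (η : ℝ) * (j.choose (i + 1) : ℝ) ≤
        j.choose i + t * (s ^ (i + 1) * t ^ (j - (i + 1)) * j.choose (i + 1)))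
    (j : ℕ) (a : ℕ → ℝ≥0∞) :
    (η : ℝ≥0∞) * ∑ i ∈ Finset.range (j + 1), (j.choose i : ℝ≥0∞) * a i ≤
      ∑ i ∈ Finset.range (j + 1), (j.choose i : ℝ≥0∞) * a (i + 1) +
      t * ∑ i ∈ Finset.range (j + 1),
        ((s : ℝ≥0∞) ^ i * (t : ℝ≥0∞) ^ (j - i) * j.choose i) * a i := by
  have key : ∀ i, i + 1 ≤ j → (η : ℝ≥0∞) * (j.choose (i + 1) : ℝ≥0∞) ≤ (j.choose i : ℝ≥0∞) +
      t * ((s : ℝ≥0∞) ^ (i + 1) * (t : ℝ≥0∞) ^ (j - (i + 1)) * j.choose (i + 1)) := by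
    intro i hi
    have := h j i hi
    exact_mod_cast this
  rw [Finset.sum_range_succ' (fun i => (j.choose i : ℝ≥0∞) * a i),
    Finset.sum_range_succ' (fun i => ((s : ℝ≥0∞) ^ i * (t : ℝ≥0∞) ^ (j - i) * j.choose i) * a i),
    Finset.sum_range_succ, mul_add, mul_add, Finset.mul_sum, Finset.mul_sum]
  -- The index-zero term has no predecessor in the shifted sum, so the error must absorb it; `η ≤ t`
  -- and `1 ≤ t` serve this purpose.
  have h0 : (η : ℝ≥0∞) * ((j.choose 0 : ℝ≥0∞) * a 0) ≤
      t * (((s : ℝ≥0∞) ^ 0 * (t : ℝ≥0∞) ^ (j - 0) * j.choose 0) * a 0) := by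
    simp only [Nat.choose_zero_right, Nat.cast_one, one_mul, pow_zero, mul_one, Nat.sub_zero]
    gcongr
    exact le_mul_of_one_le_left zero_le (one_le_pow₀ (by exact_mod_cast ht1))
  have h1 : ∑ i ∈ Finset.range j, (η : ℝ≥0∞) * ((j.choose (i + 1) : ℝ≥0∞) * a (i + 1)) ≤
      ∑ i ∈ Finset.range j, (j.choose i : ℝ≥0∞) * a (i + 1) +
      ∑ i ∈ Finset.range j, t * (((s : ℝ≥0∞) ^ (i + 1) * (t : ℝ≥0∞) ^ (j - (i + 1)) *
        j.choose (i + 1)) * a (i + 1)) := by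
    rw [← Finset.sum_add_distrib]
    refine Finset.sum_le_sum fun i hi => ?_
    rw [← mul_assoc, ← mul_assoc (t : ℝ≥0∞), ← add_mul]
    gcongr
    exact key i (by simpa [Nat.succ_le_iff] using hi)
  calc _ ≤ _ := add_le_add h1 h0
    _ ≤ _ := by
      rw [add_assoc]
      gcongr
      exact le_self_add

theorem one_add_pow_smoothing {η s t : ℝ≥0} (hηt : η ≤ t) (ht1 : 1 ≤ t)
    (h : ∀ j i : ℕ, i + 1 ≤ j → (η : ℝ) * (j.choose (i + 1) : ℝ) ≤
        j.choose i + t * (s ^ (i + 1) * t ^ (j - (i + 1)) * j.choose (i + 1)))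
    (T : Module.End ℝ≥0∞ (S → ℝ≥0∞)) (j : ℕ) (f : S → ℝ≥0∞) (z : S) :
    (η : ℝ≥0∞) * ((1 + T) ^ j) f z ≤
      T (((1 + T) ^ j) f) z +
        t * (((t : ℝ≥0∞) • (1 : Module.End ℝ≥0∞ (S → ℝ≥0∞)) + (s : ℝ≥0∞) • T) ^ j) f z := by
  have e1 : ((1 + T) ^ j) f = ∑ i ∈ Finset.range (j + 1), (j.choose i : ℝ≥0∞) • (T ^ i) f := by
    rw [add_comm, (Commute.one_right T).add_pow, LinearMap.sum_apply]
    refine Finset.sum_congr rfl fun i _ => ?_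
    simp [Module.End.mul_apply, Module.End.natCast_apply, ← Nat.cast_smul_eq_nsmul ℝ≥0∞]
  have e2 : (((t : ℝ≥0∞) • (1 : Module.End ℝ≥0∞ (S → ℝ≥0∞)) + (s : ℝ≥0∞) • T) ^ j) f =
      ∑ i ∈ Finset.range (j + 1),
        ((s : ℝ≥0∞) ^ i * (t : ℝ≥0∞) ^ (j - i) * j.choose i) • (T ^ i) f := by
    rw [add_comm, ((Commute.one_right T).smul_right _ |>.smul_left _).add_pow, LinearMap.sum_apply]
    refine Finset.sum_congr rfl fun i _ => ?_
    simp [smul_pow, Module.End.mul_apply, Module.End.natCast_apply, ← Nat.cast_smul_eq_nsmul ℝ≥0∞,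
      smul_smul, mul_assoc, mul_comm]
  have := sum_binomial_smoothing hηt ht1 h j (fun i => (T ^ i) f z)
  rw [e2, e1, map_sum]
  simpa [Finset.sum_apply, pow_succ'] using this

/-- Because `R` commutes with both operators, the two powers expand with the same binomial weights
and the same powers of `R`, so the estimate passes through term by term. -/
theorem add_pow_smoothing {η ε t : ℝ≥0∞} {T A B R : Module.End ℝ≥0∞ (S → ℝ≥0∞)}
    (hAR : Commute A R) (hBR : Commute B R)
    (h : ∀ (j : ℕ) (f : S → ℝ≥0∞) (z : S),
      η * (A ^ j) f z ≤ T ((A ^ j) f) z + t * (B ^ j) f z)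
    (n : ℕ) (f : S → ℝ≥0∞) (z : S) :
    η * ((ε • A + R) ^ n) f z ≤
      T (((ε • A + R) ^ n) f) z + t * ((ε • B + R) ^ n) f z := by
  have e : ∀ D : Module.End ℝ≥0∞ (S → ℝ≥0∞), Commute D R →
      ((ε • D + R) ^ n) f = ∑ j ∈ Finset.range (n + 1),
        (ε ^ j) • (D ^ j) ((R ^ (n - j)) ((n.choose j : ℝ≥0∞) • f)) := by
    intro D hD
    rw [(hD.smul_left ε).add_pow, LinearMap.sum_apply]
    refine Finset.sum_congr rfl fun i _ => ?_
    simp [smul_pow, Module.End.mul_apply, Module.End.natCast_apply, ← Nat.cast_smul_eq_nsmul ℝ≥0∞]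
  rw [e A hAR, e B hBR, map_sum]
  simp only [Finset.sum_apply, Finset.mul_sum]
  rw [← Finset.sum_add_distrib]
  refine Finset.sum_le_sum fun j _ => ?_
  generalize (R ^ (n - j)) ((n.choose j : ℝ≥0∞) • f) = g
  simp only [LinearMap.map_smul, Pi.smul_apply, smul_eq_mul]
  rw [mul_left_comm, mul_left_comm t, ← mul_add]
  gcongr
  exact h j _ z

theorem pow_apply_le {A : Module.End ℝ≥0∞ (S → ℝ≥0∞)} {ρ : ℝ≥0∞}
    (hA : ∀ z, A 1 z ≤ ρ) (n : ℕ) {f : S → ℝ≥0∞} (hf : f ≤ 1) (z : S) :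
    (A ^ n) f z ≤ ρ ^ n := by
  induction n generalizing z with
  | zero => simpa using hf z
  | succ n ih =>
    rw [pow_succ', Module.End.mul_apply, pow_succ]
    have h1 : (A ^ n) f ≤ ρ ^ n • (1 : S → ℝ≥0∞) := fun u => by simpa using ih u
    refine (end_mono A h1 z).trans ?_
    rw [LinearMap.map_smul, Pi.smul_apply, smul_eq_mul]
    gcongr
    exact hA z

theorem exists_geometric_smoothing {ε η : ℝ≥0} (hε : 0 < ε) (hη : η < 1) :
    ∃ t ρ : ℝ≥0, 0 < ρ ∧ ρ < 1 ∧ ∀ T R : Module.End ℝ≥0∞ (S → ℝ≥0∞), Commute T R → T 1 = 1 →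
      (∀ z, ((ε : ℝ≥0∞) • (1 + T) + R) 1 z ≤ 1) → ∀ (n : ℕ) (f : S → ℝ≥0∞), f ≤ 1 → ∀ z,
      (η : ℝ≥0∞) * (((ε : ℝ≥0∞) • (1 + T) + R) ^ n) f z ≤
        T ((((ε : ℝ≥0∞) • (1 + T) + R) ^ n) f) z + t * (ρ : ℝ≥0∞) ^ n := by
  obtain ⟨s, t, hst, hηt, ht1, h⟩ := exists_smoothing_weights (η := η) η.2 (by exact_mod_cast hη)
  obtain ⟨σ, hσ⟩ := exists_add_of_le hst.le
  have hσ0 : 0 < σ := by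
    rcases eq_or_ne σ 0 with rfl | h0
    · simp [hσ] at hst
    · exact pos_iff_ne_zero.2 h0
  -- Replacing `1 + T` by `t + s T` lowers the total mass by `ε (2 - s - t) = ε σ`. The maximum with
  -- `1 / 2` only keeps the rate positive, as needed for taking roots of it later.
  refine ⟨t, max (1 - ε * σ) (1 / 2), by simp, ?_, ?_⟩
  · refine max_lt ?_ ?_
    · exact tsub_lt_self one_pos (mul_pos hε hσ0)
    · exact NNReal.half_lt_self one_ne_zero
  intro T R hTR hT1 hsub n f hf z
  have hAR : Commute (1 + T) R := (Commute.one_left R).add_left hTR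
  have hBR : Commute ((t : ℝ≥0∞) • (1 : Module.End ℝ≥0∞ (S → ℝ≥0∞)) + (s : ℝ≥0∞) • T) R :=
    ((Commute.one_left R).smul_left _).add_left (hTR.smul_left _)
  refine (add_pow_smoothing (ε := (ε : ℝ≥0∞)) (T := T) (t := t) hAR hBR
    (fun j f z => one_add_pow_smoothing (by exact_mod_cast hηt) ht1 h T j f z) n f z).trans ?_
  gcongr
  refine pow_apply_le (fun u => ?_) n hf z
  have h1 := hsub u
  have h2 : ((1 - ε * σ : ℝ≥0) : ℝ≥0∞) ≤ (max (1 - ε * σ) (1 / 2) : ℝ≥0) := by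
    exact_mod_cast le_max_left _ _
  refine le_trans ?_ h2
  rw [ENNReal.coe_sub]
  refine ENNReal.le_sub_of_add_le_right ENNReal.coe_ne_top ?_
  refine le_trans (le_of_eq ?_) h1
  have h3 : (s : ℝ≥0∞) + t + σ = 2 := by exact_mod_cast hσ.symm
  simp only [LinearMap.add_apply, LinearMap.smul_apply, Module.End.one_apply, hT1, Pi.add_apply,
    Pi.smul_apply, Pi.one_apply, smul_eq_mul, mul_one, ENNReal.coe_mul]
  rw [one_add_one_eq_two, ← h3]
  ring

end Smoothing

/-! ### Kernels as operators, and translations. -/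

section Transfer

variable {S : Type*}

/-- The operator on nonnegative functions given by a nonnegative kernel. -/
noncomputable def transfer (κ : S → S → ℝ≥0∞) : Module.End ℝ≥0∞ (S → ℝ≥0∞) where
  toFun f z := ∑' u, κ z u * f u
  map_add' f g := by
    ext z
    simp [mul_add, ENNReal.tsum_add]
  map_smul' c f := by
    ext z
    simp [mul_left_comm, ENNReal.tsum_mul_left]

theorem transfer_apply (κ : S → S → ℝ≥0∞) (f : S → ℝ≥0∞) (z : S) :
    transfer κ f z = ∑' u, κ z u * f u := rfl

end Transfer

variable {d k : ℕ} {E : Set (Fin k → ℤ)}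

theorem shift_zero (z : State d E) : shift z 0 = z := by simp [shift]

theorem shift_add (z : State d E) (v w : Fin d → ℤ) :
    shift z (v + w) = shift (shift z v) w := by simp [shift, add_assoc]

theorem shift_shift_neg (z : State d E) (w : Fin d → ℤ) : shift (shift z w) (-w) = z := by
  rw [← shift_add, add_neg_cancel, shift_zero]

theorem shift_neg_shift (z : State d E) (w : Fin d → ℤ) : shift (shift z (-w)) w = z := by
  rw [← shift_add, neg_add_cancel, shift_zero]

/-- Translation by `w` as a permutation of the states. -/
def shiftEquiv (w : Fin d → ℤ) : State d E ≃ State d E where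
  toFun z := shift z w
  invFun z := shift z (-w)
  left_inv z := shift_shift_neg z w
  right_inv z := shift_neg_shift z w

theorem shiftEquiv_apply (w : Fin d → ℤ) (z : State d E) : shiftEquiv w z = shift z w := rfl

/-- The operator of translation by `w`. -/
noncomputable def translate (w : Fin d → ℤ) : Module.End ℝ≥0∞ (State d E → ℝ≥0∞) :=
  LinearMap.funLeft ℝ≥0∞ ℝ≥0∞ (fun z => shift z w)

theorem translate_apply (w : Fin d → ℤ) (f : State d E → ℝ≥0∞) (z : State d E) :
    translate w f z = f (shift z w) := rfl

theorem translate_commute_transfer (w : Fin d → ℤ) {κ : State d E → State d E → ℝ≥0∞}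
    (hκ : ∀ z u, κ (shift z w) (shift u w) = κ z u) : Commute (translate w) (transfer κ) := by
  refine LinearMap.ext fun f => funext fun z => ?_
  simp only [Module.End.mul_apply, translate_apply, transfer_apply]
  rw [← (shiftEquiv w).tsum_eq]
  simp only [shiftEquiv_apply, hκ]

/-! ### Transition probabilities and their local smoothing. -/

namespace Chain

variable (P : Chain d E)

theorem p_shift (w : Fin d → ℤ) (z u : State d E) : P.p (shift z w) (shift u w) = P.p z u := by
  obtain ⟨x, y⟩ := z
  obtain ⟨x', y'⟩ := u
  simp only [shift]
  rw [P.additive, P.additive x x']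
  congr 2
  abel

theorem step_zero (z u : State d E) : P.step 0 z u = if z = u then 1 else 0 := rfl

theorem step_succ (n : ℕ) (z u : State d E) :
    P.step (n + 1) z u = ∑' v, P.p z v * P.step n v u := rfl

theorem step_shift (n : ℕ) (w : Fin d → ℤ) (z u : State d E) :
    P.step n (shift z w) (shift u w) = P.step n z u := by
  induction n generalizing z with
  | zero =>
    have : shift z w = shift u w ↔ z = u := (shiftEquiv w).injective.eq_iff
    simp [step_zero, this]
  | succ n ih =>
    rw [step_succ, step_succ, ← (shiftEquiv w).tsum_eq]
    simp only [shiftEquiv_apply, p_shift, ih]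

theorem transfer_pow_apply (n : ℕ) (f : State d E → ℝ≥0∞) (z : State d E) :
    (transfer P.p ^ n) f z = ∑' u, P.step n z u * f u := by
  induction n generalizing z with
  | zero =>
    rw [tsum_eq_single z fun u hu => by simp [step_zero, hu.symm]]
    simp [step_zero]
  | succ n ih =>
    rw [pow_succ', Module.End.mul_apply, transfer_apply]
    simp only [ih, step_succ, ← ENNReal.tsum_mul_left, ← ENNReal.tsum_mul_right]
    rw [ENNReal.tsum_comm]
    simp only [mul_assoc]

theorem transfer_step (n : ℕ) : transfer (P.step n) = transfer P.p ^ n :=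
  LinearMap.ext fun f => funext fun z => (P.transfer_pow_apply n f z).symm

theorem step_eq_transfer_pow (n : ℕ) (z u : State d E) :
    P.step n z u = (transfer P.p ^ n) (fun v => P.step 0 v u) z := by
  rw [transfer_pow_apply, tsum_eq_single u fun v hv => by simp [step_zero, hv]]
  simp [step_zero]

theorem step_add (m n : ℕ) (z u : State d E) :
    P.step (m + n) z u = ∑' v, P.step m z v * P.step n v u := by
  rw [step_eq_transfer_pow, pow_add, Module.End.mul_apply, transfer_pow_apply]
  simp only [← step_eq_transfer_pow]

theorem step_mul_step_le (m n : ℕ) (z v u : State d E) :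
    P.step m z v * P.step n v u ≤ P.step (m + n) z u := by
  rw [step_add]
  exact ENNReal.le_tsum v

theorem tsum_step_le_one (n : ℕ) (z : State d E) : ∑' u, P.step n z u ≤ 1 := by
  have h := pow_apply_le (A := transfer P.p) (ρ := 1)
    (fun z => by simpa [transfer_apply] using P.substochastic z) n (le_refl 1) z
  simpa [transfer_pow_apply] using h

theorem step_le_one (n : ℕ) (z u : State d E) : P.step n z u ≤ 1 :=
  (ENNReal.le_tsum u).trans (P.tsum_step_le_one n z)

theorem p_le_one (z u : State d E) : P.p z u ≤ 1 :=
  (ENNReal.le_tsum u).trans (P.substochastic z)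

/-- Local form of the smoothing estimate, along the multiples of a time `N` at which the chain may
stay or move by `w` with uniformly positive probabilities. -/
theorem smoothing_of_minorized {N : ℕ} {w : Fin d → ℤ} {ε : ℝ≥0} (hε : 0 < ε)
    (h0 : ∀ z, 2 * (ε : ℝ≥0∞) ≤ P.step N z z)
    (hw : ∀ z, 2 * (ε : ℝ≥0∞) ≤ P.step N z (shift z w)) {η : ℝ≥0} (hη : η < 1) :
    ∃ t ρ : ℝ≥0, 0 < ρ ∧ ρ < 1 ∧ ∀ q r z u, (η : ℝ≥0∞) * P.step (N * q + r) z u ≤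
      P.step (N * q + r) (shift z w) u + t * (ρ : ℝ≥0∞) ^ q := by
  obtain ⟨t, ρ, hρ0, hρ1, H⟩ := exists_geometric_smoothing (S := State d E) hε hη
  refine ⟨t, ρ, hρ0, hρ1, fun q r z u => ?_⟩
  -- When translation by `w` fixes `z` the two atoms coincide and have mass `2 ε`, hence the factor
  -- `2` in the hypotheses.
  let κ : State d E → State d E → ℝ≥0∞ := fun z u =>
    (if u = z then (ε : ℝ≥0∞) else 0) + (if u = shift z w then (ε : ℝ≥0∞) else 0)
  have hκ : ∀ z u, κ z u ≤ P.step N z u := by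
    intro z u
    have two : (ε : ℝ≥0∞) ≤ 2 * ε := by rw [two_mul]; exact le_self_add
    by_cases h1 : u = z
    · subst h1
      refine le_trans ?_ (h0 u)
      rw [two_mul]
      simp only [κ, if_true]
      gcongr
      split_ifs <;> simp
    · by_cases h2 : u = shift z w
      · simp only [κ, if_neg h1, if_pos h2, zero_add]
        rw [h2]
        exact two.trans (hw z)
      · simp [κ, h1, h2]
  have hκs : ∀ z u, κ (shift z w) (shift u w) = κ z u := by
    intro z u
    have e1 : shift u w = shift z w ↔ u = z := (shiftEquiv w).injective.eq_iff
    have e2 : shift u w = shift (shift z w) w ↔ u = shift z w := (shiftEquiv w).injective.eq_iff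
    simp only [κ, e1, e2]
  let R := transfer (fun z u => P.step N z u - κ z u)
  have hTR : Commute (translate w) R :=
    translate_commute_transfer w fun z u => by rw [step_shift, hκs]
  have hQ : (ε : ℝ≥0∞) • (1 + translate w) + R = transfer P.p ^ N := by
    rw [← transfer_step]
    refine LinearMap.ext fun f => funext fun z => ?_
    have e : ∀ u, P.step N z u * f u = (((if u = z then (ε : ℝ≥0∞) else 0) * f u) +
        ((if u = shift z w then (ε : ℝ≥0∞) else 0) * f u)) + (P.step N z u - κ z u) * f u := by
      intro u
      rw [← add_mul, ← add_mul]
      congr 1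
      exact (add_tsub_cancel_of_le (hκ z u)).symm
    simp only [transfer_apply, e, ENNReal.tsum_add, R, LinearMap.add_apply, LinearMap.smul_apply,
      Pi.add_apply, Pi.smul_apply, translate_apply, Module.End.one_apply, smul_eq_mul, ite_mul,
      zero_mul, tsum_ite_eq, mul_add]
  have h := H (translate w) R hTR rfl (fun z => by
    rw [hQ, transfer_pow_apply]
    simpa using P.tsum_step_le_one N z) q (fun v => P.step r v u) (fun v => P.step_le_one r v u) z
  rw [hQ, ← pow_mul, translate_apply, transfer_pow_apply, transfer_pow_apply, ← step_add,
    ← step_add] at h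
  exact h

/-- Paths between arbitrary states, of length and probability controlled by the distance. -/
theorem Communication.exists_le_step {P : Chain d E} (h : P.Communication) :
    ∃ θ : ℝ≥0, 0 < θ ∧ θ ≤ 1 ∧ ∃ C : ℝ, 0 < C ∧ ∀ z z' : State d E,
      ∃ n : ℕ, (n : ℝ) ≤ C * ‖pos z' - pos z‖ ∧ (θ : ℝ≥0∞) ^ n ≤ P.step n z z' := by
  obtain ⟨θ, C, hθ, hC, H⟩ := h
  refine ⟨min θ.toNNReal 1, lt_min (Real.toNNReal_pos.2 hθ) one_pos, min_le_right _ _, C, hC, ?_⟩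
  intro z z'
  rcases eq_or_ne z z' with rfl | hz
  · exact ⟨0, by simp, by simp [step_zero]⟩
  obtain ⟨n, ζ, h0, hn, hlen, hstep⟩ := H z z' hz
  refine ⟨n, hlen, ?_⟩
  have key : ∀ m ≤ n, ((min θ.toNNReal 1 : ℝ≥0) : ℝ≥0∞) ^ m ≤ P.step m (ζ (n - m)) (ζ n) := by
    intro m
    induction m with
    | zero => intro _; simp [step_zero]
    | succ m ih =>
      intro hm
      rw [pow_succ', step_succ]
      refine le_trans ?_ (ENNReal.le_tsum (ζ (n - m)))
      have h1 := (hstep (n - (m + 1)) (by omega)).2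
      rw [show n - (m + 1) + 1 = n - m by omega] at h1
      refine mul_le_mul' (le_trans ?_ h1) (ih (by omega))
      rw [ENNReal.ofReal]
      exact_mod_cast min_le_left _ _
  simpa [h0, hn] using key n le_rfl

theorem iInf_step_pos_of_mem_closure {n : ℕ} (hn : n ∈ AddSubmonoid.closure P.returnTimes) :
    0 < ⨅ z, P.step n z z := by
  induction hn using AddSubmonoid.closure_induction with
  | mem n hn => exact hn.2
  | zero =>
    refine lt_of_lt_of_le one_pos (le_iInf fun z => ?_)
    simp [step_zero]
  | add m n _ _ hm hn =>
    refine lt_of_lt_of_le (ENNReal.mul_pos hm.ne' hn.ne') (le_iInf fun z => ?_)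
    exact (mul_le_mul' (iInf_le _ z) (iInf_le _ z)).trans (P.step_mul_step_le m n z z z)

theorem norm_pos_shift_sub (z z' : State d E) (w : Fin d → ℤ) :
    ‖pos (shift z w) - pos z‖ = ‖pos (shift z' w) - pos z'‖ := by
  congr 1
  ext i
  rcases i with i | i <;> simp [pos, shift]

theorem step_pow_le_step_mul (n j : ℕ) (z : State d E) (w : Fin d → ℤ) :
    P.step n z (shift z w) ^ j ≤ P.step (n * j) z (shift z (j • w)) := by
  induction j with
  | zero => simp [step_zero, shift_zero]
  | succ j ih =>
    rw [pow_succ, mul_add_one, succ_nsmul, shift_add]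
    refine le_trans ?_ (P.step_mul_step_le _ _ z (shift z (j • w)) _)
    gcongr
    rw [← P.step_shift n (j • w), ← shift_add, ← shift_add, add_comm]

/-- The length `n` of a path from `z` to `z + w` depends on `z`, but is bounded. Repeating its
displacement `kHat` times reaches `z + kHat w` at time `kHat * n`, a multiple of `kHat`. The time
left until `N` is then a large multiple of the gcd, at which returns are uniformly likely. -/
theorem exists_minorized (hA1 : P.Communication) (hk : P.kHat ≠ 0) (w : Fin d → ℤ) :
    ∃ N : ℕ, 0 < N ∧ ∃ ε : ℝ≥0, 0 < ε ∧ (∀ z, 2 * (ε : ℝ≥0∞) ≤ P.step N z z) ∧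
      ∀ z, 2 * (ε : ℝ≥0∞) ≤ P.step N z (shift z (P.kHat • w)) := by
  obtain ⟨θ, hθ0, hθ1, C, hC, H⟩ := hA1.exists_le_step
  obtain ⟨N₀, hN₀⟩ := Nat.exists_mem_closure_of_ge P.returnTimes
  rcases isEmpty_or_nonempty (State d E) with hE | ⟨⟨a⟩⟩
  · exact ⟨1, one_pos, 1, one_pos, fun z => hE.elim z, fun z => hE.elim z⟩
  obtain ⟨L, hL⟩ := exists_nat_ge (C * ‖pos (shift a w) - pos a‖)
  -- The margin `L + 1` keeps every remaining time `N - kHat * n`, `n ≤ L`, beyond the threshold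
  -- `N₀`.
  set N := P.kHat * (N₀ + L + 1) with hN
  have hmem : ∀ n ≤ L, 0 < ⨅ z, P.step (N - P.kHat * n) z z := by
    intro n hn
    refine P.iInf_step_pos_of_mem_closure (hN₀ _ ?_ ?_)
    · rw [hN, ← Nat.mul_sub]
      calc N₀ ≤ N₀ + L + 1 - n := by omega
        _ ≤ _ := Nat.le_mul_of_pos_left _ (Nat.pos_of_ne_zero hk)
    · rw [hN, ← Nat.mul_sub]
      exact dvd_mul_right _ _
  obtain ⟨α, hα0, hα⟩ : ∃ α : ℝ≥0∞, 0 < α ∧ ∀ n ≤ L, ∀ z, α ≤ P.step (N - P.kHat * n) z z := by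
    refine ⟨(Finset.range (L + 1)).inf fun n => ⨅ z, P.step (N - P.kHat * n) z z, ?_, ?_⟩
    · rw [Finset.lt_inf_iff (by simp)]
      intro n hn
      exact hmem n (by simpa [Nat.lt_succ_iff] using hn)
    · intro n hn z
      exact (Finset.inf_le (by simpa [Nat.lt_succ_iff] using hn)).trans (iInf_le _ z)
  have hβ : ∀ z, α * (θ : ℝ≥0∞) ^ (L * P.kHat) ≤ P.step N z (shift z (P.kHat • w)) := by
    intro z
    obtain ⟨n, hn, hstep⟩ := H z (shift z w)
    rw [norm_pos_shift_sub z a w] at hn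
    have hnL : n ≤ L := by exact_mod_cast hn.trans hL
    have h1 : P.kHat * n ≤ N := by
      rw [hN]
      exact Nat.mul_le_mul_left _ (by omega)
    have h2 := P.step_mul_step_le (N - P.kHat * n) (P.kHat * n) z z (shift z (P.kHat • w))
    rw [Nat.sub_add_cancel h1] at h2
    refine le_trans (mul_le_mul' (hα n hnL z) ?_) h2
    rw [mul_comm P.kHat]
    refine le_trans ?_ (P.step_pow_le_step_mul n P.kHat z w)
    calc (θ : ℝ≥0∞) ^ (L * P.kHat) ≤ (θ : ℝ≥0∞) ^ (n * P.kHat) :=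
          pow_le_pow_right_of_le_one' (by exact_mod_cast hθ1) (Nat.mul_le_mul_right _ hnL)
      _ = ((θ : ℝ≥0∞) ^ n) ^ P.kHat := pow_mul _ _ _
      _ ≤ _ := by gcongr
  have hα1 : α ≤ 1 := (hα 0 (Nat.zero_le _) a).trans (P.step_le_one _ _ _)
  have hle : α * (θ : ℝ≥0∞) ^ (L * P.kHat) ≤ α :=
    mul_le_of_le_one_right' (pow_le_one' (by exact_mod_cast hθ1) _)
  have hpos : 0 < α * (θ : ℝ≥0∞) ^ (L * P.kHat) :=
    ENNReal.mul_pos hα0.ne' (pow_ne_zero _ (by exact_mod_cast hθ0.ne'))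
  have hfin : α * (θ : ℝ≥0∞) ^ (L * P.kHat) ≠ ∞ := ((hle.trans hα1).trans_lt ENNReal.one_lt_top).ne
  lift α * (θ : ℝ≥0∞) ^ (L * P.kHat) to ℝ≥0 using hfin with β
  have h2 : 2 * ((β / 2 : ℝ≥0) : ℝ≥0∞) = β := by
    rw [← ENNReal.coe_ofNat, ← ENNReal.coe_mul, mul_div_cancel₀ _ two_ne_zero]
  refine ⟨N, Nat.mul_pos (Nat.pos_of_ne_zero hk) (by omega), β / 2,
    half_pos (by exact_mod_cast hpos), fun z => ?_, fun z => ?_⟩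
  · rw [h2]
    simpa using hle.trans (hα 0 (Nat.zero_le _) z)
  · rw [h2]
    exact hβ z

/-- Uniform local smoothing with a geometric error. -/
theorem exists_step_smoothing (hA1 : P.Communication) (hk : P.kHat ≠ 0) (w : Fin d → ℤ)
    {η : ℝ≥0} (hη : η < 1) :
    ∃ t ρ : ℝ, 0 < t ∧ 0 < ρ ∧ ρ < 1 ∧ ∀ m z u, (η : ℝ≥0∞) * P.step m z u ≤
      P.step m (shift z (P.kHat • w)) u + ENNReal.ofReal (t * ρ ^ m) := by
  obtain ⟨N, hN, ε, hε, h0, hw⟩ := P.exists_minorized hA1 hk w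
  obtain ⟨t, ρ, hρ0, hρ1, H⟩ := P.smoothing_of_minorized hε h0 hw hη
  have hρ0' : (0 : ℝ) < ρ := hρ0
  have hN' : (0 : ℝ) < (N : ℝ)⁻¹ := by positivity
  have hr1 : (ρ : ℝ) ^ (N : ℝ)⁻¹ < 1 := Real.rpow_lt_one hρ0'.le hρ1 hN'
  have hrN : ((ρ : ℝ) ^ (N : ℝ)⁻¹) ^ N = ρ := Real.rpow_inv_natCast_pow hρ0'.le hN.ne'
  have hr0 : 0 < (ρ : ℝ) ^ (N : ℝ)⁻¹ := Real.rpow_pos_of_pos hρ0' _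
  set r : ℝ := (ρ : ℝ) ^ (N : ℝ)⁻¹
  -- Here `r` is the `N`-th root of `ρ`; the factor `ρ⁻¹` pays for rounding `m / N` down, and `t +
  -- 1` ensures positivity.
  refine ⟨(t + 1) * (ρ : ℝ)⁻¹, r, by positivity, hr0, hr1, fun m z u => ?_⟩
  have h := H (m / N) (m % N) z u
  rw [Nat.div_add_mod] at h
  refine h.trans ?_
  gcongr
  rw [← ENNReal.coe_pow, ← ENNReal.coe_mul, ← ENNReal.ofReal_coe_nnreal]
  refine ENNReal.ofReal_le_ofReal ?_
  push_cast
  have h1 : (ρ : ℝ) ^ (m / N) ≤ (ρ : ℝ)⁻¹ * r ^ m := by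
    rw [le_inv_mul_iff₀ hρ0', ← pow_succ', ← hrN, ← pow_mul]
    refine pow_le_pow_of_le_one hr0.le hr1.le ?_
    have := Nat.div_add_mod m N
    have := Nat.mod_lt m hN
    nlinarith
  calc (t : ℝ) * (ρ : ℝ) ^ (m / N) ≤ (t + 1) * ((ρ : ℝ)⁻¹ * r ^ m) := by
        gcongr
        linarith
    _ = _ := by ring

end Chain

/-! ### Exponential decay of transition probabilities and the Green function estimate. -/

theorem norm_le_sum_abs {ι : Type*} [Fintype ι] (v : EuclideanSpace ℝ ι) :
    ‖v‖ ≤ ∑ i, |v i| := by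
  rw [EuclideanSpace.norm_eq]
  refine Real.sqrt_le_iff.2 ⟨Finset.sum_nonneg fun i _ => abs_nonneg _, ?_⟩
  simp only [Real.norm_eq_abs]
  exact Finset.sum_sq_le_sq_sum_of_nonneg fun i _ => abs_nonneg _

/-- Some coordinate satisfies `|v i| ≥ ‖v‖ / card ι`, so exponentials along the coordinate axes
dominate. The summand `1` covers an empty index type. -/
theorem exp_norm_le {ι : Type*} [Fintype ι] (v : EuclideanSpace ℝ ι) {c : ℝ} (hc : 0 ≤ c) :
    Real.exp (c * ‖v‖) ≤ 1 + ∑ i, (Real.exp (c * Fintype.card ι * v i) +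
      Real.exp (-(c * Fintype.card ι) * v i)) := by
  rcases isEmpty_or_nonempty ι with h | h
  · have : ‖v‖ = 0 := le_antisymm ((norm_le_sum_abs v).trans (by simp)) (norm_nonneg v)
    simp [this]
  · obtain ⟨i, -, hi⟩ : ∃ i ∈ (Finset.univ : Finset ι), ‖v‖ / Fintype.card ι ≤ |v i| := by
      refine Finset.exists_le_of_sum_le Finset.univ_nonempty ?_
      rw [Finset.sum_const, Finset.card_univ, nsmul_eq_mul, mul_div_cancel₀ _ (by simp)]
      exact norm_le_sum_abs v
    have h1 : c * ‖v‖ ≤ c * Fintype.card ι * |v i| := by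
      rw [div_le_iff₀ (by positivity)] at hi
      nlinarith
    have h2 : Real.exp (c * ‖v‖) ≤ Real.exp (c * Fintype.card ι * v i) +
        Real.exp (-(c * Fintype.card ι) * v i) := by
      rcases abs_cases (v i) with ⟨h3, -⟩ | ⟨h3, -⟩
      · rw [h3] at h1
        exact (Real.exp_le_exp.2 h1).trans (le_add_of_nonneg_right (Real.exp_pos _).le)
      · rw [h3] at h1
        refine le_trans (Real.exp_le_exp.2 ?_) (le_add_of_nonneg_left (Real.exp_pos _).le)
        linarith
    refine h2.trans ((Finset.single_le_sum (f := fun i => Real.exp (c * Fintype.card ι * v i) +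
      Real.exp (-(c * Fintype.card ι) * v i)) (fun j _ => by positivity) (Finset.mem_univ i)).trans
      (le_add_of_nonneg_left zero_le_one))

variable {d k : ℕ} {E : Set (Fin k → ℤ)}

namespace Chain

variable (P : Chain d E)

/-- The weight `exp(c |u - z|)`. -/
noncomputable def expDist (c : ℝ) (z u : State d E) : ℝ≥0∞ :=
  ENNReal.ofReal (Real.exp (c * ‖pos u - pos z‖))

theorem expDist_ne_zero (c : ℝ) (z u : State d E) : expDist c z u ≠ 0 := by
  simp [expDist, Real.exp_pos]

theorem expDist_ne_top (c : ℝ) (z u : State d E) : expDist c z u ≠ ∞ := ENNReal.ofReal_ne_top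

theorem expDist_le_mul {c : ℝ} (hc : 0 ≤ c) (z v u : State d E) :
    expDist c z u ≤ expDist c z v * expDist c v u := by
  rw [expDist, expDist, expDist, ← ENNReal.ofReal_mul (Real.exp_pos _).le, ← Real.exp_add,
    ← mul_add]
  gcongr
  rw [add_comm]
  simpa using norm_add_le (pos u - pos v) (pos v - pos z)

theorem tsum_p_mul_expDist_le {c : ℝ} (hc : 0 ≤ c) (z : State d E) :
    ∑' u, P.p z u * expDist c z u ≤ 1 + ∑ i,
      (P.jumpGen z (EuclideanSpace.single i (c * Fintype.card (Fin d ⊕ Fin k))) +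
        P.jumpGen z (EuclideanSpace.single i (-(c * Fintype.card (Fin d ⊕ Fin k))))) := by
  set D : ℝ := c * Fintype.card (Fin d ⊕ Fin k) with hD
  have h : ∀ u, P.p z u * expDist c z u ≤ P.p z u + ∑ i,
      (P.p z u * ENNReal.ofReal (Real.exp (inner ℝ (EuclideanSpace.single i D)
        (pos u - pos z))) +
      P.p z u * ENNReal.ofReal (Real.exp (inner ℝ (EuclideanSpace.single i (-D))
        (pos u - pos z)))) := by
    intro u
    have h1 := exp_norm_le (pos u - pos z) hc
    rw [← hD] at h1
    simp only [← mul_add, ← Finset.mul_sum]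
    nth_rewrite 2 [← mul_one (P.p z u)]
    rw [← mul_add]
    gcongr
    rw [expDist]
    refine (ENNReal.ofReal_le_ofReal h1).trans (le_of_eq ?_)
    rw [ENNReal.ofReal_add zero_le_one (Finset.sum_nonneg fun i _ => by positivity),
      ENNReal.ofReal_one, ENNReal.ofReal_sum_of_nonneg fun i _ => by positivity]
    congr 1
    refine Finset.sum_congr rfl fun i _ => ?_
    rw [ENNReal.ofReal_add (Real.exp_pos _).le (Real.exp_pos _).le]
    simp only [EuclideanSpace.inner_single_left, conj_trivial]
  refine (ENNReal.tsum_le_tsum h).trans ?_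
  rw [ENNReal.tsum_add, Summable.tsum_finsetSum fun i _ => ENNReal.summable]
  simp only [ENNReal.tsum_add]
  exact add_le_add (P.substochastic z) le_rfl

theorem UniformExpMoments.exists_expDist_bound {P : Chain d E} (h : P.UniformExpMoments) :
    ∃ c : ℝ, 0 < c ∧ ∃ K : ℝ, 1 ≤ K ∧ ∀ z,
      ∑' u, P.p z u * expDist c z u ≤ ENNReal.ofReal K := by
  obtain ⟨r, hr, H⟩ := Metric.eventually_nhds_iff.1 h
  set D : ℝ := (Fintype.card (Fin d ⊕ Fin k) : ℝ)
  have hD : 0 ≤ D := Nat.cast_nonneg _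
  set c : ℝ := r / (2 * (D + 1))
  have hc : 0 < c := by positivity
  have hcD : c * D < r := by
    have : c * (2 * (D + 1)) = r := div_mul_cancel₀ _ (by positivity)
    nlinarith
  have hcD0 : 0 ≤ c * D := by positivity
  have hfin : ∀ (i : Fin d ⊕ Fin k) (b : ℝ), |b| < r →
      (⨆ z, P.jumpGen z (EuclideanSpace.single i b)) < ∞ := by
    intro i b hb
    refine H ?_
    rw [dist_zero_right, PiLp.norm_single]
    exact hb
  set K : ℝ≥0∞ := 1 + ∑ i, ((⨆ z, P.jumpGen z (EuclideanSpace.single i (c * D))) +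
    ⨆ z, P.jumpGen z (EuclideanSpace.single i (-(c * D)))) with hK
  have hKfin : K ≠ ∞ := by
    refine ENNReal.add_ne_top.2 ⟨ENNReal.one_ne_top, ENNReal.sum_ne_top.2 fun i _ =>
      ENNReal.add_ne_top.2 ⟨(hfin i _ ?_).ne, (hfin i _ ?_).ne⟩⟩
    · rwa [abs_of_nonneg hcD0]
    · rwa [abs_neg, abs_of_nonneg hcD0]
  refine ⟨c, hc, K.toReal, ?_, fun z => ?_⟩
  · rw [← ENNReal.toReal_one]
    exact ENNReal.toReal_mono hKfin le_self_add
  · rw [ENNReal.ofReal_toReal hKfin]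
    refine (P.tsum_p_mul_expDist_le hc.le z).trans ?_
    rw [hK]
    gcongr with i
    · exact le_iSup (fun z => P.jumpGen z (EuclideanSpace.single i (c * D))) z
    · exact le_iSup (fun z => P.jumpGen z (EuclideanSpace.single i (-(c * D)))) z

/-- The triangle inequality makes the weight submultiplicative along paths, so the one-step bound
iterates. -/
theorem step_mul_expDist_le {c : ℝ} (hc : 0 ≤ c) {K : ℝ≥0∞}
    (hK : ∀ z, ∑' u, P.p z u * expDist c z u ≤ K) (n : ℕ) (z : State d E) :
    ∑' u, P.step n z u * expDist c z u ≤ K ^ n := by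
  induction n generalizing z with
  | zero =>
    rw [tsum_eq_single z fun u hu => by simp [step_zero, hu.symm]]
    simp [step_zero, expDist]
  | succ n ih =>
    calc ∑' u, P.step (n + 1) z u * expDist c z u
        ≤ ∑' u, ∑' v, (P.p z v * expDist c z v) * (P.step n v u * expDist c v u) := by
          refine ENNReal.tsum_le_tsum fun u => ?_
          rw [step_succ, ← ENNReal.tsum_mul_right]
          refine ENNReal.tsum_le_tsum fun v => ?_
          rw [mul_mul_mul_comm]
          gcongr
          exact expDist_le_mul hc z v u
      _ = ∑' v, (P.p z v * expDist c z v) * ∑' u, P.step n v u * expDist c v u := by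
          rw [ENNReal.tsum_comm]
          simp only [ENNReal.tsum_mul_left]
      _ ≤ ∑' v, (P.p z v * expDist c z v) * K ^ n := by
          gcongr with v
          exact ih v
      _ ≤ K ^ (n + 1) := by
          rw [ENNReal.tsum_mul_right, pow_succ']
          gcongr
          exact hK z

theorem step_le_exp {c : ℝ} (hc : 0 ≤ c) {K : ℝ} (hK1 : 1 ≤ K)
    (hK : ∀ z, ∑' u, P.p z u * expDist c z u ≤ ENNReal.ofReal K) (n : ℕ) (z u : State d E) :
    P.step n z u ≤ ENNReal.ofReal (K ^ n * Real.exp (-(c * ‖pos u - pos z‖))) := by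
  have h : P.step n z u * expDist c z u ≤ ENNReal.ofReal K ^ n :=
    (ENNReal.le_tsum u).trans (P.step_mul_expDist_le hc hK n z)
  rw [← ENNReal.ofReal_pow (by linarith)] at h
  rw [Real.exp_neg, ← div_eq_mul_inv, ENNReal.ofReal_div_of_pos (Real.exp_pos _)]
  exact (ENNReal.le_div_iff_mul_le (Or.inl (expDist_ne_zero c z u))
    (Or.inl (expDist_ne_top c z u))).2 h

/-- A term that is small both for large times and, at a bounded time, for large distances, is
jointly exponentially small. -/
theorem min_geometric_exp_le {K t ρ c : ℝ} (hK : 1 ≤ K) (ht : 0 < t) (hρ0 : 0 < ρ) (hρ1 : ρ < 1)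
    (hc : 0 < c) : ∃ r c' : ℝ, 0 < r ∧ r < 1 ∧ 0 < c' ∧ ∀ (m : ℕ) (x : ℝ), 0 ≤ x →
      min (t * ρ ^ m) (K ^ m * Real.exp (-(c * x))) ≤
        (1 + t) * Real.exp (-(c' * x)) * r ^ m := by
  obtain ⟨κ, hκ⟩ : ∃ κ, κ = Real.log K := ⟨_, rfl⟩
  obtain ⟨σ, hσ⟩ : ∃ σ, σ = -Real.log ρ := ⟨_, rfl⟩
  have hκ0 : 0 ≤ κ := hκ ▸ Real.log_nonneg hK
  have hσ0 : 0 < σ := by rw [hσ]; linarith [Real.log_neg hρ0 hρ1]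
  have hKe : K = Real.exp κ := by rw [hκ, Real.exp_log (by linarith)]
  have hρe : ρ = Real.exp (-σ) := by rw [hσ, neg_neg, Real.exp_log hρ0]
  have hden : 0 < 2 * (2 * κ + σ) := by positivity
  obtain ⟨c', hc'⟩ : ∃ c', c' = c * σ / (2 * (2 * κ + σ)) := ⟨_, rfl⟩
  have hcc : c' * (2 * (2 * κ + σ)) = c * σ := by rw [hc']; exact div_mul_cancel₀ _ hden.ne'
  have hc'0 : 0 < c' := by rw [hc']; positivity
  have hle : c' ≤ c / 2 := by
    rw [hc', div_le_iff₀ hden]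
    nlinarith [mul_nonneg hc.le hκ0]
  refine ⟨Real.exp (-(σ / 2)), c', Real.exp_pos _, Real.exp_lt_one_iff.2 (by linarith), hc'0, ?_⟩
  intro m x hx
  rw [hKe, hρe, ← Real.exp_nat_mul, ← Real.exp_nat_mul, ← Real.exp_nat_mul, mul_assoc,
    ← Real.exp_add, ← Real.exp_add]
  -- Below the threshold `m ≈ c x / (2 κ + σ)` the spatial decay beats `K ^ m`; above it, half of
  -- the decay of `ρ ^ m` yields `exp (-(c' x))`. The constant `c'` is what this threshold gives.
  rcases le_total (m * (κ + σ / 2)) (c * x / 2) with h | h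
  · refine (min_le_right _ _).trans ?_
    have h1 : Real.exp (m * κ + -(c * x)) ≤ Real.exp (-(c' * x) + m * -(σ / 2)) := by
      refine Real.exp_le_exp.2 ?_
      nlinarith [mul_le_mul_of_nonneg_right hle hx]
    nlinarith [Real.exp_pos (-(c' * x) + m * -(σ / 2))]
  · refine (min_le_left _ _).trans ?_
    have h1 : Real.exp (m * -σ) ≤ Real.exp (-(c' * x) + m * -(σ / 2)) := by
      refine Real.exp_le_exp.2 ?_
      have h2 : c' * x ≤ m * (σ / 2) := by
        refine le_of_mul_le_mul_right ?_ hden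
        calc c' * x * (2 * (2 * κ + σ)) = (c * x / 2) * (2 * σ) := by linear_combination x * hcc
          _ ≤ (m * (κ + σ / 2)) * (2 * σ) := by gcongr
          _ = _ := by ring
      linarith
    nlinarith [Real.exp_pos (-(c' * x) + m * -(σ / 2)), Real.exp_pos (m * -σ)]

/-- The Green function at a translated starting point is almost bounded below by the original one,
up to an exponentially small error. -/
theorem exists_green_smoothing (hA1 : P.Communication) (hA2 : P.UniformExpMoments)
    (hk : P.kHat ≠ 0) (w : Fin d → ℤ) {η : ℝ≥0} (hη : η < 1) :
    ∃ B c : ℝ, 0 < B ∧ 0 < c ∧ ∀ z u, (η : ℝ≥0∞) * P.green z u ≤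
      P.green (shift z (P.kHat • w)) u +
        ENNReal.ofReal (B * Real.exp (-(c * ‖pos u - pos z‖))) := by
  obtain ⟨t, ρ, ht, hρ0, hρ1, H⟩ := P.exists_step_smoothing hA1 hk w hη
  obtain ⟨c, hc, K, hK1, hK⟩ := hA2.exists_expDist_bound
  obtain ⟨r, c', hr0, hr1, hc', hmin⟩ := min_geometric_exp_le hK1 ht hρ0 hρ1 hc
  have hr1' : 0 < (1 - r)⁻¹ := inv_pos.2 (by linarith)
  refine ⟨(1 + t) * (1 - r)⁻¹, c', by positivity, hc', fun z u => ?_⟩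
  have key : ∀ m, (η : ℝ≥0∞) * P.step m z u ≤ P.step m (shift z (P.kHat • w)) u +
      ENNReal.ofReal ((1 + t) * Real.exp (-(c' * ‖pos u - pos z‖)) * r ^ m) := by
    intro m
    have hm := hmin m ‖pos u - pos z‖ (norm_nonneg _)
    -- Either the smoothing error is already small enough, or `p⁽ᵐ⁾(z, u)` itself is, and then it
    -- fits inside the error.
    rcases min_le_iff.1 hm with h | h
    · exact (H m z u).trans (by gcongr)
    · refine le_trans ?_ le_add_self
      refine (mul_le_of_le_one_left' (by exact_mod_cast hη.le)).trans ?_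
      exact (P.step_le_exp hc.le hK1 hK m z u).trans (ENNReal.ofReal_le_ofReal h)
  rw [green, green, ← ENNReal.tsum_mul_left]
  refine (ENNReal.tsum_le_tsum key).trans (le_of_eq ?_)
  rw [ENNReal.tsum_add, ← ENNReal.ofReal_tsum_of_nonneg (fun m => by positivity)
    ((summable_geometric_of_lt_one hr0.le hr1).mul_left _), tsum_mul_left,
    tsum_geometric_of_lt_one hr0.le hr1]
  congr 2
  ring

end Chain

/-! ### Ratio limits and harmonic limits of Green kernels. -/

theorem tendsto_ennreal_tsum_of_dominated {α β : Type*} {l : Filter α} [l.NeBot]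
    {f : α → β → ℝ≥0∞} {g bound : β → ℝ≥0∞} (hb : ∑' b, bound b ≠ ∞)
    (h : ∀ a b, f a b ≤ bound b) (hlim : ∀ b, Tendsto (fun a => f a b) l (𝓝 (g b))) :
    Tendsto (fun a => ∑' b, f a b) l (𝓝 (∑' b, g b)) := by
  have hbb : ∀ b, bound b ≠ ∞ := ENNReal.ne_top_of_tsum_ne_top hb
  have hg : ∀ b, g b ≤ bound b := fun b => le_of_tendsto' (hlim b) fun a => h a b
  have hf' : ∀ a, ∑' b, f a b ≠ ∞ := fun a =>
    ((ENNReal.tsum_le_tsum (h a)).trans_lt hb.lt_top).ne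
  have hg' : ∑' b, g b ≠ ∞ := ((ENNReal.tsum_le_tsum hg).trans_lt hb.lt_top).ne
  rw [← ENNReal.tendsto_toReal_iff hf' hg',
    ENNReal.tsum_toReal_eq fun b => ne_top_of_le_ne_top (hbb b) (hg b)]
  simp only [fun a => ENNReal.tsum_toReal_eq fun b => ne_top_of_le_ne_top (hbb b) (h a b)]
  refine tendsto_tsum_of_dominated_convergence (ENNReal.summable_toReal hb) (fun b => ?_)
    (Eventually.of_forall fun a b => ?_)
  · exact (ENNReal.tendsto_toReal (ne_top_of_le_ne_top (hbb b) (hg b))).comp (hlim b)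
  · rw [Real.norm_of_nonneg ENNReal.toReal_nonneg]
    exact ENNReal.toReal_mono (hbb b) (h a b)

variable {d k : ℕ} {E : Set (Fin k → ℤ)}

namespace Chain

variable (P : Chain d E)

theorem step_mul_green_le (n : ℕ) (z v u : State d E) :
    P.step n z v * P.green v u ≤ P.green z u := by
  rw [green, ← ENNReal.tsum_mul_left]
  refine (ENNReal.tsum_le_tsum fun m => P.step_mul_step_le n m z v u).trans ?_
  exact ENNReal.tsum_comp_le_tsum_of_injective (add_right_injective n) (fun m => P.step m z u)

theorem green_eq (z u : State d E) :
    P.green z u = P.step 0 z u + ∑' v, P.p z v * P.green v u := by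
  rw [green, tsum_eq_zero_add' ENNReal.summable]
  simp only [step_succ, green, ← ENNReal.tsum_mul_left]
  rw [ENNReal.tsum_comm]

theorem exists_step_pos (hA1 : P.Communication) (z u : State d E) : ∃ n, 0 < P.step n z u := by
  obtain ⟨θ, hθ0, -, C, -, H⟩ := hA1.exists_le_step
  obtain ⟨n, -, hn⟩ := H z u
  exact ⟨n, lt_of_lt_of_le (ENNReal.pow_pos (by exact_mod_cast hθ0) n) hn⟩

theorem green_ne_zero (hA1 : P.Communication) (z u : State d E) : P.green z u ≠ 0 := by
  obtain ⟨n, hn⟩ := P.exists_step_pos hA1 z u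
  exact (lt_of_lt_of_le hn (ENNReal.le_tsum n)).ne'

theorem green_ne_top (htrans : P.Transient) (hA1 : P.Communication) (z u : State d E) :
    P.green z u ≠ ∞ := by
  obtain ⟨n, hn⟩ := P.exists_step_pos hA1 u z
  intro h
  have h1 := (P.step_mul_green_le n u z u).trans_lt (htrans u)
  rw [h, ENNReal.mul_top hn.ne'] at h1
  exact lt_irrefl _ h1

theorem eventually_exp_le_green {zs : ℕ → State d E}
    (hzs : Tendsto (fun n => ‖pos (zs n)‖) atTop atTop) {z₀ : State d E}
    (hgreen : 0 ≤ liminf (fun n => ENNReal.log (P.green z₀ (zs n)) /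
        ((‖pos (zs n)‖ : ℝ) : EReal)) atTop) {c : ℝ} (hc : 0 < c) :
    ∀ᶠ n in atTop, ENNReal.ofReal (Real.exp (-(c * ‖pos (zs n)‖))) ≤ P.green z₀ (zs n) := by
  have h1 : ((-c : ℝ) : EReal) < liminf (fun n => ENNReal.log (P.green z₀ (zs n)) /
        ((‖pos (zs n)‖ : ℝ) : EReal)) atTop :=
    lt_of_lt_of_le (by exact_mod_cast neg_lt_zero.2 hc) hgreen
  filter_upwards [eventually_lt_of_lt_liminf h1, hzs.eventually_gt_atTop 0] with n hn hpos
  rw [EReal.lt_div_iff (by exact_mod_cast hpos) (EReal.coe_ne_top _), ← EReal.coe_mul] at hn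
  rw [← ENNReal.log_le_log_iff, ENNReal.log_ofReal_of_pos (Real.exp_pos _), Real.log_exp]
  rw [neg_mul] at hn
  exact hn.le

/-- Passing through `z₀` bounds the denominator below by a constant times the Green function from
`z₀`. Half of the rate `c` cancels against its subexponential lower bound, and the other half tends
to zero. -/
theorem tendsto_exp_div_green (hA1 : P.Communication) {zs : ℕ → State d E}
    (hzs : Tendsto (fun n => ‖pos (zs n)‖) atTop atTop) {z₀ : State d E}
    (hgreen : 0 ≤ liminf (fun n => ENNReal.log (P.green z₀ (zs n)) /
        ((‖pos (zs n)‖ : ℝ) : EReal)) atTop) {B c : ℝ} (hB : 0 < B) (hc : 0 < c)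
    (z : State d E) :
    Tendsto (fun n => ENNReal.ofReal (B * Real.exp (-(c * ‖pos (zs n) - pos z‖))) /
      P.green z (zs n)) atTop (𝓝 0) := by
  obtain ⟨m, hm⟩ := P.exists_step_pos hA1 z z₀
  have hm' : P.step m z z₀ ≠ ∞ := ((P.step_le_one m z z₀).trans_lt ENNReal.one_lt_top).ne
  have hreal : Tendsto (fun n => B * Real.exp (c * ‖pos z‖) *
      Real.exp (-(c / 2 * ‖pos (zs n)‖))) atTop (𝓝 0) := by
    rw [← mul_zero (B * Real.exp (c * ‖pos z‖))]
    refine Tendsto.const_mul _ (Real.tendsto_exp_neg_atTop_nhds_zero.comp ?_)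
    exact hzs.const_mul_atTop (by positivity)
  have hlim : Tendsto (fun n => ENNReal.ofReal (B * Real.exp (c * ‖pos z‖) *
      Real.exp (-(c / 2 * ‖pos (zs n)‖))) / P.step m z z₀) atTop (𝓝 0) := by
    have h := ENNReal.Tendsto.div_const (b := P.step m z z₀) (ENNReal.tendsto_ofReal hreal)
      (Or.inr hm.ne')
    simpa using h
  refine tendsto_of_tendsto_of_tendsto_of_le_of_le' tendsto_const_nhds hlim
    (Eventually.of_forall fun n => zero_le) ?_
  filter_upwards [P.eventually_exp_le_green hzs hgreen (half_pos hc)] with n hn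
  set e := Real.exp (-(c / 2 * ‖pos (zs n)‖)) with he
  have he0 : 0 < e := Real.exp_pos _
  have h1 : ENNReal.ofReal (B * Real.exp (-(c * ‖pos (zs n) - pos z‖))) ≤
      ENNReal.ofReal (B * Real.exp (c * ‖pos z‖) * e) * ENNReal.ofReal e := by
    rw [← ENNReal.ofReal_mul (by positivity)]
    refine ENNReal.ofReal_le_ofReal ?_
    rw [mul_assoc, mul_assoc]
    refine mul_le_mul_of_nonneg_left ?_ hB.le
    rw [he, ← Real.exp_add, ← Real.exp_add]
    refine Real.exp_le_exp.2 ?_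
    nlinarith [norm_sub_norm_le (pos (zs n)) (pos z)]
  calc ENNReal.ofReal (B * Real.exp (-(c * ‖pos (zs n) - pos z‖))) / P.green z (zs n)
      ≤ (ENNReal.ofReal (B * Real.exp (c * ‖pos z‖) * e) * ENNReal.ofReal e) /
        (P.step m z z₀ * ENNReal.ofReal e) := by
        refine ENNReal.div_le_div h1 (le_trans ?_ (P.step_mul_green_le m z z₀ (zs n)))
        gcongr
    _ = _ := ENNReal.mul_div_mul_right _ _ (by simpa using he0) ENNReal.ofReal_ne_top

theorem eventually_lt_green_ratio (htrans : P.Transient) (hA1 : P.Communication)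
    (hA2 : P.UniformExpMoments) (hk : P.kHat ≠ 0) {zs : ℕ → State d E}
    (hzs : Tendsto (fun n => ‖pos (zs n)‖) atTop atTop) {z₀ : State d E}
    (hgreen : 0 ≤ liminf (fun n => ENNReal.log (P.green z₀ (zs n)) /
        ((‖pos (zs n)‖ : ℝ) : EReal)) atTop) (z : State d E) (w : Fin d → ℤ) {a : ℝ≥0∞}
    (ha : a < 1) :
    ∀ᶠ n in atTop, a < P.green (shift z (P.kHat • w)) (zs n) / P.green z (zs n) := by
  obtain ⟨η, haη, hη⟩ := ENNReal.lt_iff_exists_nnreal_btwn.1 ha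
  obtain ⟨B, c, hB, hc, H⟩ := P.exists_green_smoothing hA1 hA2 hk w (η := η) (by exact_mod_cast hη)
  have hlim := P.tendsto_exp_div_green hA1 hzs hgreen hB hc z
  have hpos : 0 < (η : ℝ≥0∞) - a := tsub_pos_of_lt haη
  filter_upwards [hlim.eventually (gt_mem_nhds hpos)] with n hn
  have h1 : (η : ℝ≥0∞) ≤ P.green (shift z (P.kHat • w)) (zs n) / P.green z (zs n) +
      ENNReal.ofReal (B * Real.exp (-(c * ‖pos (zs n) - pos z‖))) / P.green z (zs n) := by
    rw [ENNReal.div_add_div_same, ENNReal.le_div_iff_mul_le (Or.inl (P.green_ne_zero hA1 _ _))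
      (Or.inl (P.green_ne_top htrans hA1 _ _))]
    exact H z (zs n)
  by_contra! hcon
  have h2 : (η : ℝ≥0∞) < a + (η - a) :=
    h1.trans_lt (ENNReal.add_lt_add_of_le_of_lt (ne_top_of_lt (hcon.trans_lt ha)) hcon hn)
  rw [add_tsub_cancel_of_le haη.le] at h2
  exact lt_irrefl _ h2

/-- The ratio limit theorem for translations by multiples of `kHat`. -/
theorem tendsto_green_shift_ratio (htrans : P.Transient) (hA1 : P.Communication)
    (hA2 : P.UniformExpMoments) {zs : ℕ → State d E}
    (hzs : Tendsto (fun n => ‖pos (zs n)‖) atTop atTop) {z₀ : State d E}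
    (hgreen : 0 ≤ liminf (fun n => ENNReal.log (P.green z₀ (zs n)) /
        ((‖pos (zs n)‖ : ℝ) : EReal)) atTop) (z : State d E) (w : Fin d → ℤ) :
    Tendsto (fun n => P.green (shift z (P.kHat • w)) (zs n) / P.green z (zs n)) atTop (𝓝 1) := by
  rcases eq_or_ne P.kHat 0 with hk | hk
  · rw [hk, zero_smul, shift_zero]
    simp [ENNReal.div_self (P.green_ne_zero hA1 _ _) (P.green_ne_top htrans hA1 _ _)]
  refine tendsto_order.2 ⟨fun a ha =>
    P.eventually_lt_green_ratio htrans hA1 hA2 hk hzs hgreen z w ha, fun b hb => ?_⟩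
  -- The upper bound is the lower bound for the return translation `-w` from the shifted point,
  -- inverted.
  filter_upwards [P.eventually_lt_green_ratio htrans hA1 hA2 hk hzs hgreen
    (shift z (P.kHat • w)) (-w) (ENNReal.inv_lt_one.2 hb)] with n hn
  rw [smul_neg, shift_shift_neg] at hn
  rw [← ENNReal.inv_lt_inv, ENNReal.inv_div (Or.inl (P.green_ne_top htrans hA1 _ _))
    (Or.inl (P.green_ne_zero hA1 _ _))]
  exact hn

/-- The Green kernel normalized at `b` grows at most exponentially, uniformly in the pole. -/
theorem exists_green_ratio_le (hA1 : P.Communication) :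
    ∃ c : ℝ, 0 ≤ c ∧ ∀ b z u, P.green z u / P.green b u ≤ expDist c b z := by
  obtain ⟨θ, hθ0, hθ1, C, hC, H⟩ := hA1.exists_le_step
  have hθ0' : (0 : ℝ) < θ := hθ0
  have hlog : Real.log θ ≤ 0 := Real.log_nonpos hθ0'.le hθ1
  -- A path from `b` to `z` of length `n ≤ C |z - b|` has probability at least `θ ^ n ≥ exp (-(c |z
  -- - b|))` for this `c`.
  refine ⟨C * -Real.log θ, mul_nonneg hC.le (by linarith), fun b z u => ?_⟩
  refine ENNReal.div_le_of_le_mul ?_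
  obtain ⟨n, hn, hstep⟩ := H b z
  have h1 : (θ : ℝ≥0∞) ^ n * P.green z u ≤ P.green b u :=
    le_trans (by gcongr) (P.step_mul_green_le n b z u)
  have h2 : 1 ≤ expDist (C * -Real.log θ) b z * (θ : ℝ≥0∞) ^ n := by
    rw [expDist, ← ENNReal.ofReal_coe_nnreal, ← ENNReal.ofReal_pow hθ0'.le, ← ENNReal.ofReal_mul
      (Real.exp_pos _).le, ← ENNReal.ofReal_one]
    refine ENNReal.ofReal_le_ofReal ?_
    nth_rewrite 2 [← Real.exp_log hθ0']
    rw [← Real.exp_nat_mul, ← Real.exp_add]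
    refine Real.one_le_exp ?_
    nlinarith
  calc P.green z u ≤ expDist (C * -Real.log θ) b z * (θ : ℝ≥0∞) ^ n * P.green z u :=
        le_mul_of_one_le_left zero_le h2
    _ ≤ _ := by
      rw [mul_assoc]
      gcongr

/-- Supplies the dominating series for normalized Green kernels. Their growth rate comes from the
communication constants and need not be small, so moments near zero would not suffice. -/
theorem AllExpMoments.tsum_p_mul_expDist_ne_top {P : Chain d E} (h : P.AllExpMoments) {c : ℝ}
    (hc : 0 ≤ c) (b z : State d E) : ∑' u, P.p z u * expDist c b u ≠ ∞ := by
  have h1 : ∑' u, P.p z u * expDist c z u ≠ ∞ := by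
    refine ne_top_of_le_ne_top ?_ (P.tsum_p_mul_expDist_le hc z)
    exact ENNReal.add_ne_top.2 ⟨ENNReal.one_ne_top, ENNReal.sum_ne_top.2 fun i _ =>
      ENNReal.add_ne_top.2 ⟨(h.1 z _).ne, (h.1 z _).ne⟩⟩
  refine ne_top_of_le_ne_top (ENNReal.mul_ne_top (expDist_ne_top c b z) h1) ?_
  rw [← ENNReal.tsum_mul_left]
  refine ENNReal.tsum_le_tsum fun u => ?_
  rw [mul_left_comm]
  gcongr
  exact expDist_le_mul hc b z u

/-- Every limit of normalized Green kernels along an ultrafilter is a positive harmonic function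
that is invariant under translations by the multiples of `kHat`. -/
theorem exists_isPosPeriodicHarmonic_limit (htrans : P.Transient) (hA1 : P.Communication)
    (hA2 : P.AllExpMoments) {zs : ℕ → State d E}
    (hzs : Tendsto (fun n => ‖pos (zs n)‖) atTop atTop)
    (hratio : ∀ (z : State d E) (w : Fin d → ℤ), Tendsto (fun n =>
      P.green (shift z (P.kHat • w)) (zs n) / P.green z (zs n)) atTop (𝓝 1))
    (b : State d E) (U : Ultrafilter ℕ) (hU : (U : Filter ℕ) ≤ atTop) :
    ∃ H : State d E → ℝ≥0, P.IsPosPeriodicHarmonic H ∧ H b = 1 ∧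
      ∀ z, Tendsto (fun n => P.green z (zs n) / P.green b (zs n)) U (𝓝 (H z : ℝ≥0∞)) := by
  have hG0 := P.green_ne_zero hA1
  have hGt := P.green_ne_top htrans hA1
  obtain ⟨c, hc, hbound⟩ := P.exists_green_ratio_le hA1
  have hex : ∀ z, ∃ x : ℝ≥0∞, Tendsto (fun n => P.green z (zs n) / P.green b (zs n)) U (𝓝 x) := by
    intro z
    -- Compactness of `[0, ∞]` gives a limit at every state along the same ultrafilter, with no
    -- diagonal extraction.
    obtain ⟨x, -, hx⟩ := isCompact_univ.ultrafilter_le_nhds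
      (U.map fun n => P.green z (zs n) / P.green b (zs n)) (by simp)
    exact ⟨x, hx⟩
  choose H hH using hex
  have hfin : ∀ z, H z ≠ ∞ := fun z =>
    ne_top_of_le_ne_top (expDist_ne_top c b z) (le_of_tendsto' (hH z) fun n => hbound b z (zs n))
  lift H to State d E → ℝ≥0 using hfin
  refine ⟨H, ⟨fun z => ?_, fun z => ?_, fun z w => ?_⟩, ?_, hH⟩
  · obtain ⟨m, hm⟩ := P.exists_step_pos hA1 z b
    have h1 : P.step m z b ≤ H z := by
      refine ge_of_tendsto' (hH z) fun n => ?_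
      rw [ENNReal.le_div_iff_mul_le (Or.inl (hG0 _ _)) (Or.inl (hGt _ _))]
      exact P.step_mul_green_le m z b (zs n)
    exact_mod_cast lt_of_lt_of_le hm h1
  · have h1 : Tendsto (fun n => ∑' u, P.p z u * (P.green u (zs n) / P.green b (zs n))) U
        (𝓝 (∑' u, P.p z u * (H u : ℝ≥0∞))) := by
      refine tendsto_ennreal_tsum_of_dominated (hA2.tsum_p_mul_expDist_ne_top hc b z)
        (fun n u => ?_) fun u => ?_
      · gcongr
        exact hbound b u (zs n)
      · exact ENNReal.Tendsto.const_mul (hH u)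
          (Or.inr ((P.p_le_one z u).trans_lt ENNReal.one_lt_top).ne)
    refine tendsto_nhds_unique (h1.congr' ?_) (hH z)
    -- The Green kernel is harmonic away from its pole, and `zs n` eventually leaves `z`.
    filter_upwards [hU (hzs.eventually_gt_atTop ‖pos z‖)] with n hn
    have hne : z ≠ zs n := by
      rintro h
      rw [← h] at hn
      exact lt_irrefl _ hn
    rw [P.green_eq z (zs n), step_zero, if_neg hne, zero_add, ENNReal.div_eq_inv_mul,
      ← ENNReal.tsum_mul_left]
    simp only [ENNReal.div_eq_inv_mul, mul_left_comm]
  · have h1 := ENNReal.Tendsto.mul ((hratio z w).mono_left hU) (Or.inl one_ne_zero) (hH z)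
      (Or.inr ENNReal.one_ne_top)
    rw [one_mul] at h1
    have h2 := tendsto_nhds_unique (hH (shift z (P.kHat • w))) (h1.congr fun n => ?_)
    · exact ENNReal.coe_injective h2
    · rw [← mul_div_assoc, ENNReal.div_mul_cancel (hG0 _ _) (hGt _ _)]
  · have h1 := hH b
    simp only [ENNReal.div_self (hG0 _ _) (hGt _ _)] at h1
    exact_mod_cast (tendsto_nhds_unique h1 tendsto_const_nhds)

end Chain

end MarkovAdditive

theorem proposition3p2 {d k : ℕ} {E : Set (Fin k → ℤ)} (P : MarkovAdditive.Chain d E)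
    (htrans : P.Transient) (hA1' : P.Communication) (hA2 : P.UniformExpMoments)
    (zs : ℕ → MarkovAdditive.State d E)
    (hzs : Tendsto (fun n => ‖MarkovAdditive.pos (zs n)‖) atTop atTop)
    (hgreen : ∃ z₀ : MarkovAdditive.State d E,
      0 ≤ liminf (fun n => ENNReal.log (P.green z₀ (zs n)) /
        ((‖MarkovAdditive.pos (zs n)‖ : ℝ) : EReal)) atTop) :
    (∀ (z : MarkovAdditive.State d E) (w : Fin d → ℤ),
      Tendsto (fun n => P.green (MarkovAdditive.shift z (P.kHat • w)) (zs n) / P.green z (zs n))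
        atTop (𝓝 1)) ∧
    (P.AllExpMoments → ∀ h : MarkovAdditive.State d E → ℝ≥0, P.IsUniquePosPeriodicHarmonic h →
      ∀ z z' : MarkovAdditive.State d E,
        Tendsto (fun n => P.green z (zs n) / P.green z' (zs n)) atTop
          (𝓝 ((h z / h z' : ℝ≥0) : ℝ≥0∞))) := by
  obtain ⟨z₀, hz₀⟩ := hgreen
  have hratio := fun z w => P.tendsto_green_shift_ratio htrans hA1' hA2 hzs hz₀ z w
  -- Convergence is tested along ultrafilters. Normalizing at `z'` fixes the constant in the
  -- uniqueness statement as `1 / h z'`, so all the limits agree.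
  refine ⟨hratio, fun hA2' h hh z z' => (tendsto_iff_ultrafilter _ _ _).2 fun U hU => ?_⟩
  obtain ⟨H, hH, hH1, hlim⟩ :=
    P.exists_isPosPeriodicHarmonic_limit htrans hA1' hA2' hzs hratio z' U hU
  obtain ⟨c, hc⟩ := hh.2 H hH
  have hc1 : c * h z' = 1 := by rw [← hc, hH1]
  have e : h z / h z' = H z := by
    rw [div_eq_iff (hh.1.positive z').ne', hc, mul_right_comm, hc1, one_mul]
  rw [e]
  exact hlim z
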